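/- Let $X$ be a second-countable locally compact Hausdorff space and let $\kappa:X\times X\to[0,\infty]$ be a kernel, i.e. a symmetric lower semicontinuous function. Write $\mathfrak M^+$ for the positive Radon measures on $X$, $U^\mu(x)=\int\kappa(x,y)\,d\mu(y)$, $I(\mu,\nu)=\int\kappa\,d(\mu\otimes\nu)$ and $I(\mu)=I(\mu,\mu)$ for (signed) Radon measures, whenever these are well defined. Let $\mathcal E^+$ be the set of $\mu\in\mathfrak M^+$ with $I(\mu)<\infty$, with the strong topology given by the metric $\|\mu-\nu\|=\sqrt{I(\mu-\nu)}$; for $A\subset X$ let $\mathcal E^+(A)$ be the set of $\mu\in\mathcal E^+$ for which $X\setminus A$ is $\mu$-negligible. For compact $K$ put $c(K)=1/\inf I(\mu)$, the infimum being over all $\mu\in\mathfrak M^+$ concentrated on $K$ with $\mu(X)=1$, and let $c_*(A)=\sup\{c(K):K\subset A\text{ compact}\}$ be the inner capacity of $A$; a property holds nearly everywhere (n.e.) on $A$ if the set of points of $A$ where it fails has inner capacity $0$. Assume that $\kappa$ satisfies: - the energy principle: $I(\mu)\ge0$ for every signed Radon measure $\mu$ whose energy is well defined, with $I(\mu)=0$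 only for $\mu=0$; - the consistency principle: $\mathcal E^+$ is strongly complete and the strong topology on $\mathcal E^+$ is finer than the vague topology; - the domination principle: if $\mu\in\mathcal E^+$, $\nu\in\mathfrak M^+$ and $U^\mu\le U^\nu$ $\mu$-a.e., then $U^\mu\le U^\nu$ on $X$; - Frostman's maximum principle: if $\mu\in\mathcal E^+$, $c\in(0,\infty)$ and $U^\mu\le c$ $\mu$-a.e., then $U^\mu\le c$ on $X$. Let $A\subset X$ be a set with $0<c_*(A)<\infty$ such that $\mathcal E^+(A)$ is strongly closed. Let $\omega\in\mathfrak M^+$, $\omega\neq0$, be such that either $\omega\in\mathcal E^+$, or $\omega(X)<\infty$, $U^\omega$ is bounded on $A$ and $U^\omega|_K$ is upper semicontinuous for every compact $K\subset A$. Then there is a unique measure $\omega^A\in\mathcal E^+(A)$ with $U^{\omega^A}=U^\omega$ n.e. on $A$ (the inner balayage of $\omega$ onto $A$), and there is a unique measure $\gamma_A$ of finite energy (the inner equilibrium measure of $A$) that minimizes $I(\nu)$ over all $\nu\in\mathfrak M^+$ with $U^\nu\ge1$ n.e. on $A$. Moreover, $\gamma_A(X)=c_*(A)$, and $$\omega^A(X)=\int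 U^\omega\,d\gamma_A .$$ -/

import Mathlib

open MeasureTheory Filter Topology
open scoped ENNReal NNReal

noncomputable section

namespace BalayageTheory

variable {X : Type*} [TopologicalSpace X] [MeasurableSpace X]

/-! ### Kernels, Radon measures, potentials, energies -/

/-- A kernel on `X`: a symmetric lower semicontinuous function `X × X → [0, ∞]`. -/
structure IsKernel (κ : X → X → ℝ≥0∞) : Prop where
  symm : ∀ x y, κ x y = κ y x
  lsc : LowerSemicontinuous fun p : X × X => κ p.1 p.2

/-- Positive Radon measures on `X`. On a second-countable locally compact Hausdorff space these
are the Borel measures that are finite on compact sets (regularity is automatic). -/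
def posRadon (X : Type*) [TopologicalSpace X] [MeasurableSpace X] : Set (Measure X) :=
  {μ | IsFiniteMeasureOnCompacts μ}

/-- A signed Radon measure `σ = σ⁺ - σ⁻`, given by its Jordan decomposition (the two parts may
both have infinite total mass). -/
structure SignedRadon (X : Type*) [TopologicalSpace X] [MeasurableSpace X] where
  pos : Measure X
  neg : Measure X
  pos_mem : pos ∈ posRadon X
  neg_mem : neg ∈ posRadon X
  mutuallySingular : pos ⟂ₘ neg

/-- The potential `U^μ(x) = ∫ κ(x, y) dμ(y)` of a positive measure. -/
def potential (κ : X → X → ℝ≥0∞) (μ : Measure X) (x : X) : ℝ≥0∞ :=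
  ∫⁻ y, κ x y ∂μ

/-- The mutual energy `I(μ, ν) = ∫ κ(x, y) d(μ ⊗ ν)(x, y)` of positive measures. -/
def mutualEnergy (κ : X → X → ℝ≥0∞) (μ ν : Measure X) : ℝ≥0∞ :=
  ∫⁻ p, κ p.1 p.2 ∂(μ.prod ν)

/-- The energy `I(μ) = I(μ, μ)` of a positive measure. -/
def energy (κ : X → X → ℝ≥0∞) (μ : Measure X) : ℝ≥0∞ :=
  mutualEnergy κ μ μ

/-- `I(σ)⁺`, the integral of `κ` against the positive part of `σ ⊗ σ`. -/
def SignedRadon.energyPos (κ : X → X → ℝ≥0∞) (σ : SignedRadon X) : ℝ≥0∞ :=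
  mutualEnergy κ σ.pos σ.pos + mutualEnergy κ σ.neg σ.neg

/-- `I(σ)⁻`, the integral of `κ` against the negative part of `σ ⊗ σ`. -/
def SignedRadon.energyNeg (κ : X → X → ℝ≥0∞) (σ : SignedRadon X) : ℝ≥0∞ :=
  mutualEnergy κ σ.pos σ.neg + mutualEnergy κ σ.neg σ.pos

/-- The energy of a signed measure is well defined (finite or `±∞`) unless it is `∞ - ∞`. -/
def SignedRadon.EnergyDefined (κ : X → X → ℝ≥0∞) (σ : SignedRadon X) : Prop :=
  σ.energyPos κ ≠ ∞ ∨ σ.energyNeg κ ≠ ∞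

/-- The energy `I(σ)` of a signed measure, meaningful when `σ.EnergyDefined κ`. -/
def SignedRadon.energy (κ : X → X → ℝ≥0∞) (σ : SignedRadon X) : EReal :=
  (σ.energyPos κ : EReal) - (σ.energyNeg κ : EReal)

/-- The energy principle: `κ` is strictly positive definite, i.e. `I(σ) ≥ 0` for every signed
Radon measure `σ` whose energy is well defined, with `I(σ) = 0` only for `σ = 0`. -/
def EnergyPrinciple (κ : X → X → ℝ≥0∞) : Prop :=
  ∀ σ : SignedRadon X, σ.EnergyDefined κ →
    0 ≤ σ.energy κ ∧ (σ.energy κ = 0 → σ.pos = 0 ∧ σ.neg = 0)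

/-! ### The cone of positive measures of finite energy and its topologies -/

/-- `ℰ⁺`: the positive Radon measures of finite energy. -/
def finiteEnergy (κ : X → X → ℝ≥0∞) : Set (Measure X) :=
  {μ | μ ∈ posRadon X ∧ energy κ μ < ∞}

/-- `ℰ⁺(A)`: the measures in `ℰ⁺` concentrated on `A`, i.e. such that `Aᶜ` is `μ`-negligible. -/
def finiteEnergyOn (κ : X → X → ℝ≥0∞) (A : Set X) : Set (Measure X) :=
  {μ | μ ∈ finiteEnergy κ ∧ μ Aᶜ = 0}

/-- The energy distance on `ℰ⁺`: `‖μ - ν‖ = (I(μ) - 2 I(μ, ν) + I(ν)) ^ (1/2)`. (For `μ, ν` in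
`ℰ⁺` all three terms are finite and the sum is nonnegative, by the energy principle.) -/
def energyDist (κ : X → X → ℝ≥0∞) (μ ν : Measure X) : ℝ :=
  Real.sqrt ((energy κ μ).toReal - 2 * (mutualEnergy κ μ ν).toReal + (energy κ ν).toReal)

/-- Strong convergence `u n → μ`. -/
def StrongTendsto (κ : X → X → ℝ≥0∞) (u : ℕ → Measure X) (μ : Measure X) : Prop :=
  Tendsto (fun n => energyDist κ (u n) μ) atTop (𝓝 0)

/-- Strong Cauchy sequences. -/
def StrongCauchy (κ : X → X → ℝ≥0∞) (u : ℕ → Measure X) : Prop :=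
  ∀ ε : ℝ, 0 < ε → ∃ N : ℕ, ∀ m, N ≤ m → ∀ n, N ≤ n → energyDist κ (u m) (u n) < ε

/-- Vague convergence `u n → μ`: convergence of the integrals of continuous functions with
compact support. -/
def VagueTendsto (u : ℕ → Measure X) (μ : Measure X) : Prop :=
  ∀ φ : X → ℝ, Continuous φ → HasCompactSupport φ →
    Tendsto (fun n => ∫ x, φ x ∂(u n)) atTop (𝓝 (∫ x, φ x ∂μ))

/-- The consistency principle: `ℰ⁺` is strongly complete, and the strong topology on `ℰ⁺` is
finer than the vague one. (The strong topology is metrizable, so sequences suffice.) -/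
def ConsistencyPrinciple (κ : X → X → ℝ≥0∞) : Prop :=
  (∀ u : ℕ → Measure X, (∀ n, u n ∈ finiteEnergy κ) → StrongCauchy κ u →
    ∃ μ ∈ finiteEnergy κ, StrongTendsto κ u μ) ∧
  (∀ u : ℕ → Measure X, (∀ n, u n ∈ finiteEnergy κ) → ∀ μ ∈ finiteEnergy κ,
    StrongTendsto κ u μ → VagueTendsto u μ)

/-- The cone `ℰ⁺(A)` is strongly closed. -/
def StronglyClosedCone (κ : X → X → ℝ≥0∞) (A : Set X) : Prop :=
  ∀ u : ℕ → Measure X, (∀ n, u n ∈ finiteEnergyOn κ A) → ∀ μ ∈ finiteEnergy κ,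
    StrongTendsto κ u μ → μ ∈ finiteEnergyOn κ A

/-! ### Domination and maximum principles -/

/-- The domination principle. -/
def DominationPrinciple (κ : X → X → ℝ≥0∞) : Prop :=
  ∀ μ ∈ finiteEnergy κ, ∀ ν ∈ posRadon X,
    (∀ᵐ x ∂μ, potential κ μ x ≤ potential κ ν x) → ∀ x, potential κ μ x ≤ potential κ ν x

/-- Ugaheri's maximum principle with constant `M`. -/
def UgaheriPrinciple (κ : X → X → ℝ≥0∞) (M : ℝ≥0) : Prop :=
  ∀ μ ∈ finiteEnergy κ, ∀ c : ℝ≥0, 0 < c →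
    (∀ᵐ x ∂μ, potential κ μ x ≤ c) → ∀ x, potential κ μ x ≤ M * c

/-- Frostman's maximum principle: Ugaheri's maximum principle with constant `1`. -/
def FrostmanPrinciple (κ : X → X → ℝ≥0∞) : Prop :=
  UgaheriPrinciple κ 1

/-! ### Capacity and exceptional sets -/

/-- The capacity `c(K) = 1 / inf I(μ)` of a compact set, the infimum being over the positive
Radon measures `μ` concentrated on `K` with `μ(X) = 1` (`1 / ∞ = 0`, `1 / 0 = ∞`). -/
def capacity (κ : X → X → ℝ≥0∞) (K : Set X) : ℝ≥0∞ :=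
  (⨅ μ ∈ {μ : Measure X | μ ∈ posRadon X ∧ μ Kᶜ = 0 ∧ μ Set.univ = 1}, energy κ μ)⁻¹

/-- The inner capacity `c_*(A)`: the supremum of `c(K)` over the compact sets `K ⊆ A`. -/
def innerCapacity (κ : X → X → ℝ≥0∞) (A : Set X) : ℝ≥0∞ :=
  ⨆ K ∈ {K : Set X | IsCompact K ∧ K ⊆ A}, capacity κ K

/-- `P` holds nearly everywhere on `A`. -/
def NearlyEverywhereOn (κ : X → X → ℝ≥0∞) (A : Set X) (P : X → Prop) : Prop :=
  innerCapacity κ {x | x ∈ A ∧ ¬ P x} = 0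

/-! ### Admissible charges, inner balayage, inner equilibrium measure -/

/-- The charges to be swept: nonzero positive Radon measures `ω` that either are of finite energy,
or are bounded, with `U^ω` upper semicontinuous on every compact subset of `A` and bounded
on `A`. -/
def AdmissibleCharge (κ : X → X → ℝ≥0∞) (A : Set X) (ω : Measure X) : Prop :=
  ω ∈ posRadon X ∧ ω ≠ 0 ∧
    (ω ∈ finiteEnergy κ ∨
      (ω Set.univ < ∞ ∧
        (∀ K : Set X, IsCompact K → K ⊆ A → UpperSemicontinuousOn (potential κ ω) K) ∧
        ∃ m : ℝ≥0, ∀ x ∈ A, potential κ ω x ≤ m))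

/-- `ν` is an inner balayage of `ω` onto `A`: `ν ∈ ℰ⁺(A)` and `U^ν = U^ω` n.e. on `A`. -/
def IsInnerBalayage (κ : X → X → ℝ≥0∞) (A : Set X) (ω ν : Measure X) : Prop :=
  ν ∈ finiteEnergyOn κ A ∧
    NearlyEverywhereOn κ A fun x => potential κ ν x = potential κ ω x

/-- The class of all positive Radon measures `ν` with `U^ν ≥ 1` n.e. on `A`. -/
def equilibriumClass (κ : X → X → ℝ≥0∞) (A : Set X) : Set (Measure X) :=
  {ν | ν ∈ posRadon X ∧ NearlyEverywhereOn κ A fun x => 1 ≤ potential κ ν x}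

/-- `γ` is an inner equilibrium (capacitary) measure of `A`: it has finite energy and minimizes
the energy among all positive Radon measures `ν` with `U^ν ≥ 1` n.e. on `A`. -/
def IsInnerEquilibrium (κ : X → X → ℝ≥0∞) (A : Set X) (γ : Measure X) : Prop :=
  γ ∈ equilibriumClass κ A ∧ energy κ γ < ∞ ∧
    ∀ ν ∈ equilibriumClass κ A, energy κ γ ≤ energy κ ν

end BalayageTheory

end

noncomputable section

namespace BalayageTheory

set_option linter.unusedSectionVars false

variable {X : Type*} [TopologicalSpace X] [T2Space X] [LocallyCompactSpace X]
  [SecondCountableTopology X] [MeasurableSpace X] [BorelSpace X]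
  {κ : X → X → ℝ≥0∞} {μ ν ρ σ γ ω : Measure X} {f : X → ℝ≥0∞} {A K : Set X}

/-! ### Radon measures -/

/-! Both measures arise from one variational problem: minimize the Gauss functional `I(σ) - 2 ∫ f
dσ`, with `f = U^ω` for the balayage and `f = 1` for the equilibrium measure. If `(∫ f dσ)² ≤ C
I(σ)`, the functional is bounded below, and the parallelogram identity makes minimizing sequences
strongly Cauchy; completeness gives a limit `μ`, and the first variation gives `U^μ ≥ f` almost
everywhere for every `σ` in the cone (`IsGaussCone.exists_limit`).

On a compact `K` the limit is a minimizer. Varying it along its own ray gives `U^μ = f` `μ`-a.e.,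
and the domination principle (Frostman's when `f = 1`) yields `U^μ ≤ f` everywhere
(`exists_gauss_minimizer`). On `A`, a sequence of minimizers on compact subsets converges strongly,
the limit lies in `ℰ⁺(A)` because that cone is closed, and both inequalities survive: `U^μ = f` n.e.
on `A` (`exists_potential_eq`).

Since n.e. properties hold a.e. for measures in `ℰ⁺(A)`, `U^γ = 1` n.e. gives `σ(X) = I(γ, σ)` for
all `σ ∈ ℰ⁺(A)` (`mass_eq_lintegral`). Minimality and uniqueness of `γ` and `γ(X) = c_*(A)` follow,
and symmetry of the energy gives `ω^A(X) = I(γ, ω^A) = I(ω^A, γ) = ∫ U^ω dγ`. -/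

theorem sigmaFinite_of_mem_posRadon (hμ : μ ∈ posRadon X) : SigmaFinite μ := by
  have : IsFiniteMeasureOnCompacts μ := hμ
  infer_instance

theorem regular_of_mem_posRadon (hμ : μ ∈ posRadon X) : μ.Regular := by
  have : IsFiniteMeasureOnCompacts μ := hμ
  let _ := TopologicalSpace.metrizableSpaceMetric X
  infer_instance

theorem posRadon_of_le (hν : ν ∈ posRadon X) (h : μ ≤ ν) : μ ∈ posRadon X := by
  refine ⟨fun K hK => (h K).trans_lt ?_⟩
  have : IsFiniteMeasureOnCompacts ν := hν
  exact hK.measure_lt_top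

theorem posRadon_add (hμ : μ ∈ posRadon X) (hν : ν ∈ posRadon X) : μ + ν ∈ posRadon X := by
  have : IsFiniteMeasureOnCompacts μ := hμ
  have : IsFiniteMeasureOnCompacts ν := hν
  refine ⟨fun K hK => ?_⟩
  simpa using ⟨hK.measure_lt_top, hK.measure_lt_top⟩

theorem posRadon_smul (hμ : μ ∈ posRadon X) (c : ℝ≥0) : c • μ ∈ posRadon X := by
  have : IsFiniteMeasureOnCompacts μ := hμ
  refine ⟨fun K hK => ?_⟩
  exact ENNReal.mul_lt_top ENNReal.coe_lt_top hK.measure_lt_top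

/-! ### Mutual energies of positive measures -/

theorem IsKernel.measurable (hκ : IsKernel κ) : Measurable fun p : X × X => κ p.1 p.2 :=
  hκ.lsc.measurable

theorem measurable_potential (hκ : IsKernel κ) (hμ : μ ∈ posRadon X) :
    Measurable (potential κ μ) := by
  have := sigmaFinite_of_mem_posRadon hμ
  exact hκ.measurable.lintegral_prod_right'

theorem mutualEnergy_eq_lintegral (hκ : IsKernel κ) (hν : ν ∈ posRadon X) :
    mutualEnergy κ μ ν = ∫⁻ x, potential κ ν x ∂μ := by
  have := sigmaFinite_of_mem_posRadon hν
  exact lintegral_prod _ hκ.measurable.aemeasurable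

theorem mutualEnergy_comm (hκ : IsKernel κ) (hμ : μ ∈ posRadon X) (hν : ν ∈ posRadon X) :
    mutualEnergy κ μ ν = mutualEnergy κ ν μ := by
  have := sigmaFinite_of_mem_posRadon hμ
  have := sigmaFinite_of_mem_posRadon hν
  rw [mutualEnergy, lintegral_prod_symm _ hκ.measurable.aemeasurable,
    mutualEnergy_eq_lintegral hκ hμ]
  simp only [potential, hκ.symm]

theorem mutualEnergy_mono {μ' ν' : Measure X} (hκ : IsKernel κ) (hν' : ν' ∈ posRadon X)
    (h : μ ≤ μ') (h' : ν ≤ ν') : mutualEnergy κ μ ν ≤ mutualEnergy κ μ' ν' := by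
  rw [mutualEnergy_eq_lintegral hκ (posRadon_of_le hν' h'), mutualEnergy_eq_lintegral hκ hν']
  exact lintegral_mono' h fun x => lintegral_mono' h' le_rfl

theorem mutualEnergy_add_left (hκ : IsKernel κ) (hρ : ρ ∈ posRadon X) :
    mutualEnergy κ (μ + ν) ρ = mutualEnergy κ μ ρ + mutualEnergy κ ν ρ := by
  simp only [mutualEnergy_eq_lintegral hκ hρ, lintegral_add_measure]

theorem mutualEnergy_add_right (hκ : IsKernel κ) (hμ : μ ∈ posRadon X) (hν : ν ∈ posRadon X)
    (hρ : ρ ∈ posRadon X) :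
    mutualEnergy κ ρ (μ + ν) = mutualEnergy κ ρ μ + mutualEnergy κ ρ ν := by
  rw [mutualEnergy_comm hκ hρ (posRadon_add hμ hν), mutualEnergy_add_left hκ hρ,
    mutualEnergy_comm hκ hμ hρ, mutualEnergy_comm hκ hν hρ]

theorem mutualEnergy_smul_left (hκ : IsKernel κ) (hρ : ρ ∈ posRadon X) (c : ℝ≥0) :
    mutualEnergy κ (c • μ) ρ = c * mutualEnergy κ μ ρ := by
  simp only [mutualEnergy_eq_lintegral hκ hρ, lintegral_smul_measure]
  rfl

/-! ### Jordan decomposition and the energy principle -/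

/-- The energy principle speaks only of mutually singular pairs. With densities `f`, `g` relative to
`μ + ν`, the common part has density `min f g`; truncated subtraction leaves parts living on
disjoint sets. No total mass need be finite. -/
theorem exists_jordan (hμ : μ ∈ posRadon X) (hν : ν ∈ posRadon X) :
    ∃ (s : SignedRadon X) (m : Measure X), μ = s.pos + m ∧ ν = s.neg + m := by
  have := sigmaFinite_of_mem_posRadon hμ
  have := sigmaFinite_of_mem_posRadon hν
  set l := μ + ν with hl
  set f := μ.rnDeriv l
  set g := ν.rnDeriv l
  have hf : Measurable f := Measure.measurable_rnDeriv _ _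
  have hg : Measurable g := Measure.measurable_rnDeriv _ _
  have hμl : l.withDensity f = μ :=
    Measure.withDensity_rnDeriv_eq _ _ (Measure.le_add_right le_rfl).absolutelyContinuous
  have hνl : l.withDensity g = ν :=
    Measure.withDensity_rnDeriv_eq _ _ (Measure.le_add_left le_rfl).absolutelyContinuous
  have h1 : μ = l.withDensity (f - g) + l.withDensity (f ⊓ g) := by
    rw [← withDensity_add_left (hf.sub hg)]
    conv_lhs => rw [← hμl]
    congr 1
    funext x
    simp [tsub_add_min]
  have h2 : ν = l.withDensity (g - f) + l.withDensity (f ⊓ g) := by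
    rw [← withDensity_add_left (hg.sub hf)]
    conv_lhs => rw [← hνl]
    congr 1
    funext x
    simp [min_comm (f x), tsub_add_min]
  refine ⟨⟨l.withDensity (f - g), l.withDensity (g - f), ?_, ?_, ?_⟩, l.withDensity (f ⊓ g),
    h1, h2⟩
  · refine posRadon_of_le hμ ?_
    conv_rhs => rw [h1]
    exact Measure.le_add_right le_rfl
  · refine posRadon_of_le hν ?_
    conv_rhs => rw [h2]
    exact Measure.le_add_right le_rfl
  · have hm : MeasurableSet {x | f x ≤ g x} := measurableSet_le hf hg
    refine ⟨{x | f x ≤ g x}, hm, ?_, ?_⟩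
    · rw [withDensity_apply _ hm, setLIntegral_eq_zero hm]
      intro x hx
      exact tsub_eq_zero_of_le hx
    · rw [withDensity_apply _ hm.compl, setLIntegral_eq_zero hm.compl]
      intro x hx
      exact tsub_eq_zero_of_le (not_le.1 (show ¬ f x ≤ g x from hx)).le

/-- The consequences of the energy principle for the difference of two positive measures. -/
theorem two_mul_mutualEnergy_le (hκ : IsKernel κ) (hE : EnergyPrinciple κ)
    (hμ : μ ∈ finiteEnergy κ) (hν : ν ∈ finiteEnergy κ) :
    mutualEnergy κ μ ν ≠ ∞ ∧
    2 * mutualEnergy κ μ ν ≤ energy κ μ + energy κ ν ∧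
    (2 * mutualEnergy κ μ ν = energy κ μ + energy κ ν → μ = ν) := by
  obtain ⟨s, m, h1, h2⟩ := exists_jordan hμ.1 hν.1
  have hp := s.pos_mem
  have hn := s.neg_mem
  have hpμ : s.pos ≤ μ := h1 ▸ Measure.le_add_right le_rfl
  have hmμ : m ≤ μ := h1 ▸ Measure.le_add_left le_rfl
  have hnν : s.neg ≤ ν := h2 ▸ Measure.le_add_right le_rfl
  have hmν : m ≤ ν := h2 ▸ Measure.le_add_left le_rfl
  have hm : m ∈ posRadon X := posRadon_of_le hμ.1 hmμ
  have fpp : mutualEnergy κ s.pos s.pos ≠ ∞ :=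
    ((mutualEnergy_mono hκ hμ.1 hpμ hpμ).trans_lt hμ.2).ne
  have fpm : mutualEnergy κ s.pos m ≠ ∞ :=
    ((mutualEnergy_mono hκ hμ.1 hpμ hmμ).trans_lt hμ.2).ne
  have fmm : mutualEnergy κ m m ≠ ∞ :=
    ((mutualEnergy_mono hκ hμ.1 hmμ hmμ).trans_lt hμ.2).ne
  have fnn : mutualEnergy κ s.neg s.neg ≠ ∞ :=
    ((mutualEnergy_mono hκ hν.1 hnν hnν).trans_lt hν.2).ne
  have fmn : mutualEnergy κ m s.neg ≠ ∞ :=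
    ((mutualEnergy_mono hκ hν.1 hmν hnν).trans_lt hν.2).ne
  have hfp : s.energyPos κ ≠ ∞ := ENNReal.add_ne_top.2 ⟨fpp, fnn⟩
  obtain ⟨hs0, hs1⟩ := hE s (Or.inl hfp)
  -- The cross energy is not known to be finite beforehand. As the positive part is finite, the
  -- energy is defined, and its nonnegativity excludes `-∞`.
  have hle : s.energyNeg κ ≤ s.energyPos κ := by
    have hs2 := hs0
    rw [SignedRadon.energy, EReal.sub_nonneg (by simp [hfp]) (by simp)] at hs2
    exact_mod_cast hs2
  have hcomm : mutualEnergy κ s.neg s.pos = mutualEnergy κ s.pos s.neg :=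
    mutualEnergy_comm hκ hn hp
  have fpn : mutualEnergy κ s.pos s.neg ≠ ∞ :=
    (ENNReal.add_ne_top.1 (hle.trans_lt hfp.lt_top).ne).1
  have e1 : mutualEnergy κ μ ν = mutualEnergy κ s.pos s.neg + mutualEnergy κ s.pos m +
      (mutualEnergy κ m s.neg + mutualEnergy κ m m) := by
    conv_lhs => rw [h1, h2]
    rw [mutualEnergy_add_left hκ (posRadon_add hn hm), mutualEnergy_add_right hκ hn hm hp,
      mutualEnergy_add_right hκ hn hm hm]
  have e2 : energy κ μ = mutualEnergy κ s.pos s.pos + mutualEnergy κ s.pos m +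
      (mutualEnergy κ s.pos m + mutualEnergy κ m m) := by
    conv_lhs => rw [energy, h1]
    rw [mutualEnergy_add_left hκ (posRadon_add hp hm), mutualEnergy_add_right hκ hp hm hp,
      mutualEnergy_add_right hκ hp hm hm, mutualEnergy_comm hκ hm hp]
  have e3 : energy κ ν = mutualEnergy κ s.neg s.neg + mutualEnergy κ m s.neg +
      (mutualEnergy κ m s.neg + mutualEnergy κ m m) := by
    conv_lhs => rw [energy, h2]
    rw [mutualEnergy_add_left hκ (posRadon_add hn hm), mutualEnergy_add_right hκ hn hm hn,
      mutualEnergy_add_right hκ hn hm hm, mutualEnergy_comm hκ hn hm]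
  -- The common part `m` contributes the same finite amount to both sides, so it cancels.
  have e4 : energy κ μ + energy κ ν = s.energyPos κ + (2 * mutualEnergy κ s.pos m +
      2 * mutualEnergy κ m s.neg + 2 * mutualEnergy κ m m) := by
    rw [e2, e3, SignedRadon.energyPos]; ring
  have e5 : 2 * mutualEnergy κ μ ν = s.energyNeg κ + (2 * mutualEnergy κ s.pos m +
      2 * mutualEnergy κ m s.neg + 2 * mutualEnergy κ m m) := by
    rw [e1, SignedRadon.energyNeg, hcomm]; ring
  refine ⟨?_, ?_, ?_⟩
  · rw [e1]; simp [fpn, fpm, fmn, fmm]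
  · rw [e4, e5]; gcongr
  · intro h
    rw [e4, e5, ENNReal.add_left_inj] at h
    · have : s.energy κ = 0 := by
        rw [SignedRadon.energy, h, EReal.sub_self] <;> simp [hfp]
      obtain ⟨h3, h4⟩ := hs1 this
      rw [h1, h2, h3, h4]
    · simp [fpm, fmn, fmm, ENNReal.mul_eq_top]

/-! ### The energy pairing on the cone of measures of finite energy -/

/-- The mutual energy as a real number. -/
def pairing (κ : X → X → ℝ≥0∞) (μ ν : Measure X) : ℝ := (mutualEnergy κ μ ν).toReal

/-- The square of the energy distance. -/
def sqDist (κ : X → X → ℝ≥0∞) (μ ν : Measure X) : ℝ :=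
  pairing κ μ μ - 2 * pairing κ μ ν + pairing κ ν ν

theorem pairing_nonneg : 0 ≤ pairing κ μ ν := ENNReal.toReal_nonneg

theorem energyDist_eq : energyDist κ μ ν = √(sqDist κ μ ν) := rfl

theorem mutualEnergy_ne_top (hκ : IsKernel κ) (hE : EnergyPrinciple κ)
    (hμ : μ ∈ finiteEnergy κ) (hν : ν ∈ finiteEnergy κ) : mutualEnergy κ μ ν ≠ ∞ :=
  (two_mul_mutualEnergy_le hκ hE hμ hν).1

theorem finiteEnergy_of_le (hκ : IsKernel κ) (hν : ν ∈ finiteEnergy κ) (h : μ ≤ ν) :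
    μ ∈ finiteEnergy κ :=
  ⟨posRadon_of_le hν.1 h, (mutualEnergy_mono hκ hν.1 h h).trans_lt hν.2⟩

theorem finiteEnergy_restrict (hκ : IsKernel κ) (hν : ν ∈ finiteEnergy κ) (B : Set X) :
    ν.restrict B ∈ finiteEnergy κ :=
  finiteEnergy_of_le hκ hν Measure.restrict_le_self

theorem zero_mem_finiteEnergy : (0 : Measure X) ∈ finiteEnergy κ := by
  refine ⟨⟨fun K _ => by simp⟩, ?_⟩
  simp [energy, mutualEnergy]

theorem finiteEnergy_add (hκ : IsKernel κ) (hE : EnergyPrinciple κ)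
    (hμ : μ ∈ finiteEnergy κ) (hν : ν ∈ finiteEnergy κ) : μ + ν ∈ finiteEnergy κ := by
  refine ⟨posRadon_add hμ.1 hν.1, ?_⟩
  rw [energy, mutualEnergy_add_left hκ (posRadon_add hμ.1 hν.1),
    mutualEnergy_add_right hκ hμ.1 hν.1 hμ.1, mutualEnergy_add_right hκ hμ.1 hν.1 hν.1]
  have h := fun {μ ν : Measure X} => mutualEnergy_ne_top (μ := μ) (ν := ν) hκ hE
  simp [lt_top_iff_ne_top, h hμ hμ, h hμ hν, h hν hμ, h hν hν]

theorem mutualEnergy_smul_right (hκ : IsKernel κ) (hμ : μ ∈ posRadon X) (hρ : ρ ∈ posRadon X)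
    (c : ℝ≥0) : mutualEnergy κ ρ (c • μ) = c * mutualEnergy κ ρ μ := by
  rw [mutualEnergy_comm hκ hρ (posRadon_smul hμ c), mutualEnergy_smul_left hκ hρ,
    mutualEnergy_comm hκ hμ hρ]

theorem energy_smul (hκ : IsKernel κ) (hμ : μ ∈ posRadon X) (c : ℝ≥0) :
    energy κ (c • μ) = c * (c * energy κ μ) := by
  rw [energy, mutualEnergy_smul_left hκ (posRadon_smul hμ c), mutualEnergy_smul_right hκ hμ hμ,
    energy]

theorem finiteEnergy_smul (hκ : IsKernel κ) (hμ : μ ∈ finiteEnergy κ) (c : ℝ≥0) :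
    c • μ ∈ finiteEnergy κ := by
  refine ⟨posRadon_smul hμ.1 c, ?_⟩
  rw [energy_smul hκ hμ.1]
  exact ENNReal.mul_lt_top ENNReal.coe_lt_top (ENNReal.mul_lt_top ENNReal.coe_lt_top hμ.2)

theorem pairing_comm (hκ : IsKernel κ) (hμ : μ ∈ finiteEnergy κ) (hν : ν ∈ finiteEnergy κ) :
    pairing κ μ ν = pairing κ ν μ := by
  rw [pairing, mutualEnergy_comm hκ hμ.1 hν.1, pairing]

theorem pairing_add_left (hκ : IsKernel κ) (hE : EnergyPrinciple κ) (hμ : μ ∈ finiteEnergy κ)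
    (hν : ν ∈ finiteEnergy κ) (hρ : ρ ∈ finiteEnergy κ) :
    pairing κ (μ + ν) ρ = pairing κ μ ρ + pairing κ ν ρ := by
  rw [pairing, mutualEnergy_add_left hκ hρ.1,
    ENNReal.toReal_add (mutualEnergy_ne_top hκ hE hμ hρ) (mutualEnergy_ne_top hκ hE hν hρ)]
  rfl

theorem pairing_add_right (hκ : IsKernel κ) (hE : EnergyPrinciple κ) (hμ : μ ∈ finiteEnergy κ)
    (hν : ν ∈ finiteEnergy κ) (hρ : ρ ∈ finiteEnergy κ) :
    pairing κ ρ (μ + ν) = pairing κ ρ μ + pairing κ ρ ν := by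
  rw [pairing_comm hκ hρ (finiteEnergy_add hκ hE hμ hν), pairing_add_left hκ hE hμ hν hρ,
    pairing_comm hκ hμ hρ, pairing_comm hκ hν hρ]

theorem pairing_smul_left (hκ : IsKernel κ) (hρ : ρ ∈ posRadon X) (c : ℝ≥0) :
    pairing κ (c • μ) ρ = c * pairing κ μ ρ := by
  rw [pairing, mutualEnergy_smul_left hκ hρ, ENNReal.toReal_mul]
  rfl

theorem pairing_smul_right (hκ : IsKernel κ) (hμ : μ ∈ posRadon X) (hρ : ρ ∈ posRadon X)
    (c : ℝ≥0) : pairing κ ρ (c • μ) = c * pairing κ ρ μ := by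
  rw [pairing, mutualEnergy_smul_right hκ hμ hρ, ENNReal.toReal_mul]
  rfl

theorem sqDist_nonneg (hκ : IsKernel κ) (hE : EnergyPrinciple κ) (hμ : μ ∈ finiteEnergy κ)
    (hν : ν ∈ finiteEnergy κ) : 0 ≤ sqDist κ μ ν := by
  have h := ENNReal.toReal_mono (ENNReal.add_ne_top.2 ⟨hμ.2.ne, hν.2.ne⟩)
    (two_mul_mutualEnergy_le hκ hE hμ hν).2.1
  rw [ENNReal.toReal_mul, ENNReal.toReal_add hμ.2.ne hν.2.ne] at h
  simp only [ENNReal.toReal_ofNat] at h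
  simp only [sqDist, pairing]
  simp only [energy] at h
  linarith

theorem eq_of_sqDist_eq_zero (hκ : IsKernel κ) (hE : EnergyPrinciple κ)
    (hμ : μ ∈ finiteEnergy κ) (hν : ν ∈ finiteEnergy κ) (h : sqDist κ μ ν = 0) : μ = ν := by
  refine (two_mul_mutualEnergy_le hκ hE hμ hν).2.2 ?_
  have hf := mutualEnergy_ne_top hκ hE hμ hν
  rw [← ENNReal.toReal_eq_toReal_iff' (ENNReal.mul_ne_top (by simp) hf)
    (ENNReal.add_ne_top.2 ⟨hμ.2.ne, hν.2.ne⟩), ENNReal.toReal_mul,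
    ENNReal.toReal_add hμ.2.ne hν.2.ne]
  simp only [sqDist, pairing] at h
  simp only [energy, ENNReal.toReal_ofNat]
  linarith

theorem sqDist_comm (hκ : IsKernel κ) (hμ : μ ∈ finiteEnergy κ) (hν : ν ∈ finiteEnergy κ) :
    sqDist κ μ ν = sqDist κ ν μ := by
  rw [sqDist, sqDist, pairing_comm hκ hμ hν]
  ring

/-- Cauchy–Schwarz for `μ - ν` against `σ`: the quadratic `t ↦ ‖t(μ - ν) + σ‖²` has nonpositive
discriminant. To stay with positive measures, `tμ + σ` is compared with `tν`, and the roles of `μ`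
and `ν` are exchanged for negative `t`. -/
theorem sq_pairing_sub_le (hκ : IsKernel κ) (hE : EnergyPrinciple κ) (hμ : μ ∈ finiteEnergy κ)
    (hν : ν ∈ finiteEnergy κ) (hσ : σ ∈ finiteEnergy κ) :
    (pairing κ μ σ - pairing κ ν σ) ^ 2 ≤ sqDist κ μ ν * pairing κ σ σ := by
  have key : ∀ μ ν : Measure X, μ ∈ finiteEnergy κ → ν ∈ finiteEnergy κ → ∀ t : ℝ, 0 ≤ t →
      0 ≤ sqDist κ μ ν * (t * t) + 2 * (pairing κ μ σ - pairing κ ν σ) * t + pairing κ σ σ := by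
    intro μ ν hμ hν t ht
    lift t to ℝ≥0 using ht
    have hμt := finiteEnergy_smul hκ hμ t
    have hνt := finiteEnergy_smul hκ hν t
    have h := sqDist_nonneg hκ hE (finiteEnergy_add hκ hE hμt hσ) hνt
    rw [sqDist, pairing_add_left hκ hE hμt hσ (finiteEnergy_add hκ hE hμt hσ),
      pairing_add_right hκ hE hμt hσ hμt, pairing_add_right hκ hE hμt hσ hσ,
      pairing_add_left hκ hE hμt hσ hνt, pairing_comm hκ hσ hμt, pairing_comm hκ hσ hνt] at h
    simp only [pairing_smul_left hκ hμt.1, pairing_smul_left hκ hνt.1, pairing_smul_left hκ hσ.1,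
      pairing_smul_right hκ hμ.1 hμ.1, pairing_smul_right hκ hν.1 hμ.1,
      pairing_smul_right hκ hν.1 hν.1] at h
    rw [sqDist]
    linarith
  have h := discrim_le_zero (a := sqDist κ μ ν) (b := 2 * (pairing κ μ σ - pairing κ ν σ))
    (c := pairing κ σ σ) fun t => by
      rcases le_total 0 t with ht | ht
      · exact key μ ν hμ hν t ht
      · have := key ν μ hν hμ (-t) (neg_nonneg.2 ht)
        rw [sqDist_comm hκ hν hμ] at this
        linarith
  rw [discrim] at h
  linarith

theorem sq_pairing_le (hκ : IsKernel κ) (hE : EnergyPrinciple κ) (hμ : μ ∈ finiteEnergy κ)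
    (hσ : σ ∈ finiteEnergy κ) : pairing κ μ σ ^ 2 ≤ pairing κ μ μ * pairing κ σ σ := by
  have h := sq_pairing_sub_le hκ hE hμ zero_mem_finiteEnergy hσ
  simpa [sqDist, pairing, mutualEnergy] using h

/-! ### Strong convergence -/

theorem StrongTendsto.sqDist (hκ : IsKernel κ) (hE : EnergyPrinciple κ) {u : ℕ → Measure X}
    (hu : ∀ n, u n ∈ finiteEnergy κ) (hμ : μ ∈ finiteEnergy κ) (h : StrongTendsto κ u μ) :
    Tendsto (fun n => sqDist κ (u n) μ) atTop (𝓝 0) := by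
  have h2 := h.pow 2
  simp only [energyDist_eq] at h2
  simpa [Real.sq_sqrt (sqDist_nonneg hκ hE (hu _) hμ)] using h2

theorem StrongTendsto.pairing (hκ : IsKernel κ) (hE : EnergyPrinciple κ) {u : ℕ → Measure X}
    (hu : ∀ n, u n ∈ finiteEnergy κ) (hμ : μ ∈ finiteEnergy κ) (h : StrongTendsto κ u μ)
    (hσ : σ ∈ finiteEnergy κ) :
    Tendsto (fun n => pairing κ (u n) σ) atTop (𝓝 (pairing κ μ σ)) := by
  have h1 := (h.sqDist hκ hE hu hμ).mul_const (BalayageTheory.pairing κ σ σ)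
  rw [zero_mul] at h1
  have h2 := squeeze_zero (fun n => sq_nonneg _)
    (fun n => sq_pairing_sub_le hκ hE (hu n) hμ hσ) h1
  have h3 := h2.sqrt
  simp only [Real.sqrt_sq_eq_abs, Real.sqrt_zero] at h3
  exact tendsto_sub_nhds_zero_iff.1 ((tendsto_zero_iff_abs_tendsto_zero _).2 h3)

theorem StrongTendsto.pairing_self (hκ : IsKernel κ) (hE : EnergyPrinciple κ)
    {u : ℕ → Measure X} (hu : ∀ n, u n ∈ finiteEnergy κ) (hμ : μ ∈ finiteEnergy κ)
    (h : StrongTendsto κ u μ) :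
    Tendsto (fun n => BalayageTheory.pairing κ (u n) (u n)) atTop
      (𝓝 (BalayageTheory.pairing κ μ μ)) := by
  have h1 := ((h.sqDist hκ hE hu hμ).add ((h.pairing hκ hE hu hμ hμ).const_mul 2)).sub_const
    (BalayageTheory.pairing κ μ μ)
  convert h1 using 2
  · rw [BalayageTheory.sqDist]; ring
  · ring

/-! ### The Gauss variational problem -/

/-- The Gauss functional `I(σ) - 2 ∫ f dσ`. -/
def gauss (κ : X → X → ℝ≥0∞) (f : X → ℝ≥0∞) (σ : Measure X) : ℝ :=
  pairing κ σ σ - 2 * (∫⁻ x, f x ∂σ).toReal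

/-- A convex cone of measures of finite energy on which the integral of `f` is dominated by a
multiple of the energy norm. -/
structure IsGaussCone (κ : X → X → ℝ≥0∞) (f : X → ℝ≥0∞) (C : ℝ≥0) (S : Set (Measure X)) :
    Prop where
  subset : S ⊆ finiteEnergy κ
  zero_mem : 0 ∈ S
  add_mem : ∀ μ ∈ S, ∀ ν ∈ S, μ + ν ∈ S
  smul_mem : ∀ μ ∈ S, ∀ c : ℝ≥0, c • μ ∈ S
  bound : ∀ μ ∈ S, (∫⁻ x, f x ∂μ) ^ 2 ≤ C * energy κ μ

variable {C : ℝ≥0} {S : Set (Measure X)}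

theorem IsGaussCone.lintegral_ne_top (hS : IsGaussCone κ f C S) (hμ : μ ∈ S) :
    ∫⁻ x, f x ∂μ ≠ ∞ := by
  have h := (hS.bound μ hμ).trans_lt (ENNReal.mul_lt_top ENNReal.coe_lt_top (hS.subset hμ).2)
  exact fun h' => by simp [h'] at h

theorem IsGaussCone.neg_le_gauss (hS : IsGaussCone κ f C S) (hμ : μ ∈ S) :
    -(C : ℝ) ≤ gauss κ f μ := by
  have h := ENNReal.toReal_mono (ENNReal.mul_ne_top ENNReal.coe_ne_top (hS.subset hμ).2.ne)
    (hS.bound μ hμ)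
  rw [ENNReal.toReal_pow, ENNReal.toReal_mul, ENNReal.coe_toReal] at h
  have hp : 0 ≤ pairing κ μ μ := pairing_nonneg
  have h2 : 2 * (∫⁻ x, f x ∂μ).toReal ≤ pairing κ μ μ + C := by
    -- Squaring reduces the claim to `4 C I(μ) ≤ (I(μ) + C)²`.
    rw [← pow_le_pow_iff_left₀ (by positivity) (by positivity) two_ne_zero]
    change _ ≤ C * pairing κ μ μ at h
    nlinarith [sq_nonneg (pairing κ μ μ - C)]
  rw [gauss]
  linarith

theorem IsGaussCone.exists_minimizing (hS : IsGaussCone κ f C S) :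
    ∃ (u : ℕ → Measure X) (j : ℝ), (∀ n, u n ∈ S) ∧ (∀ σ ∈ S, j ≤ gauss κ f σ) ∧
      Tendsto (fun n => gauss κ f (u n)) atTop (𝓝 j) := by
  have hb : BddBelow (gauss κ f '' S) :=
    ⟨-C, by rintro _ ⟨μ, hμ, rfl⟩; exact hS.neg_le_gauss hμ⟩
  obtain ⟨v, -, hv, hvS⟩ := exists_seq_tendsto_sInf (⟨_, 0, hS.zero_mem, rfl⟩ :
    (gauss κ f '' S).Nonempty) hb
  choose u hu huv using hvS
  refine ⟨u, _, hu, fun σ hσ => csInf_le hb ⟨σ, hσ, rfl⟩, ?_⟩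
  simpa only [huv] using hv

theorem IsGaussCone.toReal_add (hS : IsGaussCone κ f C S) (hμ : μ ∈ S) (hν : ν ∈ S) :
    (∫⁻ x, f x ∂(μ + ν)).toReal = (∫⁻ x, f x ∂μ).toReal + (∫⁻ x, f x ∂ν).toReal := by
  rw [lintegral_add_measure, ENNReal.toReal_add (hS.lintegral_ne_top hμ) (hS.lintegral_ne_top hν)]

theorem toReal_lintegral_smul (c : ℝ≥0) :
    (∫⁻ x, f x ∂(c • μ)).toReal = c * (∫⁻ x, f x ∂μ).toReal := by
  rw [lintegral_smul_measure]
  exact ENNReal.toReal_mul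

theorem IsGaussCone.gauss_add_smul (hκ : IsKernel κ) (hE : EnergyPrinciple κ)
    (hS : IsGaussCone κ f C S) (hμ : μ ∈ S) (hν : ν ∈ S) (t : ℝ≥0) :
    gauss κ f (μ + t • ν) = gauss κ f μ +
      2 * t * (pairing κ μ ν - (∫⁻ x, f x ∂ν).toReal) + t ^ 2 * pairing κ ν ν := by
  have hμ' := hS.subset hμ
  have hν' := hS.subset hν
  have htν := finiteEnergy_smul hκ hν' t
  rw [gauss, hS.toReal_add hμ (hS.smul_mem ν hν t), toReal_lintegral_smul,
    pairing_add_left hκ hE hμ' htν (finiteEnergy_add hκ hE hμ' htν),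
    pairing_add_right hκ hE hμ' htν hμ', pairing_add_right hκ hE hμ' htν htν,
    pairing_comm hκ htν hμ', pairing_smul_left hκ htν.1,
    pairing_smul_right hκ hν'.1 hμ'.1, pairing_smul_right hκ hν'.1 hν'.1, gauss]
  ring

theorem gauss_smul (hκ : IsKernel κ) (hμ : μ ∈ finiteEnergy κ) (t : ℝ≥0) :
    gauss κ f (t • μ) = t ^ 2 * pairing κ μ μ - 2 * t * (∫⁻ x, f x ∂μ).toReal := by
  rw [gauss, toReal_lintegral_smul, pairing_smul_left hκ (posRadon_smul hμ.1 t),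
    pairing_smul_right hκ hμ.1 hμ.1]
  ring

/-- This is the parallelogram identity; the linear term of the functional cancels. -/
theorem IsGaussCone.sqDist_add_gauss (hκ : IsKernel κ) (hE : EnergyPrinciple κ)
    (hS : IsGaussCone κ f C S) (hμ : μ ∈ S) (hν : ν ∈ S) :
    sqDist κ μ ν + 4 * gauss κ f ((2⁻¹ : ℝ≥0) • (μ + ν)) =
      2 * gauss κ f μ + 2 * gauss κ f ν := by
  have hμ' := hS.subset hμ
  have hν' := hS.subset hν
  rw [gauss_smul hκ (finiteEnergy_add hκ hE hμ' hν'), hS.toReal_add hμ hν,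
    pairing_add_left hκ hE hμ' hν' (finiteEnergy_add hκ hE hμ' hν'),
    pairing_add_right hκ hE hμ' hν' hμ', pairing_add_right hκ hE hμ' hν' hν',
    pairing_comm hκ hν' hμ', sqDist, gauss, gauss]
  push_cast
  ring

theorem IsGaussCone.strongCauchy (hκ : IsKernel κ) (hE : EnergyPrinciple κ)
    (hS : IsGaussCone κ f C S) {u : ℕ → Measure X} {j : ℝ} (hu : ∀ n, u n ∈ S)
    (hj : ∀ σ ∈ S, j ≤ gauss κ f σ) (h : Tendsto (fun n => gauss κ f (u n)) atTop (𝓝 j)) :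
    StrongCauchy κ u := by
  intro ε hε
  -- The midpoint has value at least `j`, so two values below `j + ε² / 4` force a squared distance
  -- below `ε²`.
  have hlt : j < j + ε ^ 2 / 4 := by
    have : 0 < ε ^ 2 := by positivity
    linarith
  obtain ⟨N, hN⟩ := eventually_atTop.1 (h.eventually_lt_const hlt)
  refine ⟨N, fun m hm n hn => ?_⟩
  rw [energyDist_eq, Real.sqrt_lt' hε]
  have h1 := hS.sqDist_add_gauss hκ hE (hu m) (hu n)
  have h2 := hj _ (hS.smul_mem _ (hS.add_mem _ (hu m) _ (hu n)) 2⁻¹)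
  linarith [hN m hm, hN n hn]

theorem nonneg_of_forall_pos_quadratic {a b : ℝ} (h : ∀ t : ℝ, 0 < t → 0 ≤ 2 * t * a + t ^ 2 * b) :
    0 ≤ a := by
  have h1 : Tendsto (fun t : ℝ => 2 * a + t * b) (𝓝[>] 0) (𝓝 (2 * a + 0 * b)) := by
    apply Tendsto.mono_left _ nhdsWithin_le_nhds
    exact (by fun_prop : Continuous fun t : ℝ => 2 * a + t * b).tendsto 0
  have h2 := ge_of_tendsto h1 (b := 0) (by
    filter_upwards [self_mem_nhdsWithin] with t ht
    have ht' : 0 < t := ht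
    have := h t ht'
    exact nonneg_of_mul_nonneg_right (by linarith : 0 ≤ t * (2 * a + t * b)) ht')
  linarith

/-- First variation along `u n + tσ`, passed to the limit in `n` before `t → 0`. This way the limit
`μ` need not belong to `S`, nor attain the infimum. -/
theorem IsGaussCone.le_pairing (hκ : IsKernel κ) (hE : EnergyPrinciple κ)
    (hS : IsGaussCone κ f C S) {u : ℕ → Measure X} {j : ℝ} (hu : ∀ n, u n ∈ S)
    (hj : ∀ σ ∈ S, j ≤ gauss κ f σ) (h : Tendsto (fun n => gauss κ f (u n)) atTop (𝓝 j))
    (hμ : μ ∈ finiteEnergy κ) (huμ : StrongTendsto κ u μ) (hσ : σ ∈ S) :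
    (∫⁻ x, f x ∂σ).toReal ≤ pairing κ μ σ := by
  rw [← sub_nonneg]
  refine nonneg_of_forall_pos_quadratic (b := pairing κ σ σ) fun t ht => ?_
  lift t to ℝ≥0 using ht.le
  have h1 := huμ.pairing hκ hE (fun n => hS.subset (hu n)) hμ (hS.subset hσ)
  have h2 := ((h.add ((h1.sub_const (∫⁻ x, f x ∂σ).toReal).const_mul (2 * t : ℝ))).add_const
    (t ^ 2 * pairing κ σ σ))
  have h3 := ge_of_tendsto' h2 (b := j) fun n => by
    rw [← hS.gauss_add_smul hκ hE (hu n) hσ]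
    exact hj _ (hS.add_mem _ (hu n) _ (hS.smul_mem _ hσ t))
  linarith

/-- The opposite inequality to `le_pairing` at `σ = μ`: the minimizer may also be shrunk, to `(1 -
t)μ`. -/
theorem IsGaussCone.pairing_self_le (hκ : IsKernel κ)
    (hS : IsGaussCone κ f C S) (hμ : μ ∈ S) (hj : ∀ σ ∈ S, gauss κ f μ ≤ gauss κ f σ) :
    pairing κ μ μ ≤ (∫⁻ x, f x ∂μ).toReal := by
  have hp : 0 ≤ pairing κ μ μ := pairing_nonneg
  rw [← sub_nonneg]
  refine nonneg_of_forall_pos_quadratic (b := pairing κ μ μ) fun t ht => ?_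
  rcases le_total t 1 with h1 | h1
  · obtain ⟨s, hs⟩ : ∃ s : ℝ≥0, (s : ℝ) = 1 - t := ⟨⟨1 - t, by linarith⟩, rfl⟩
    have h2 := hj _ (hS.smul_mem μ hμ s)
    rw [gauss_smul hκ (hS.subset hμ), gauss, hs] at h2
    linarith
  -- For `t ≥ 1` the measure `(1 - t)μ` is unavailable; comparison with `0` gives `I(μ) ≤ 2 ∫ f dμ`,
  -- which suffices.
  · have h2 := hj _ (hS.zero_mem)
    simp only [gauss, pairing, mutualEnergy] at h2
    simp only [Measure.prod_zero, lintegral_zero_measure, ENNReal.toReal_zero] at h2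
    change pairing κ μ μ - _ ≤ _ at h2
    nlinarith [mul_nonneg ht.le hp, mul_nonneg (mul_nonneg ht.le hp) (sub_nonneg.2 h1)]

/-- Minimizing sequences for the Gauss functional converge strongly, and the limit satisfies the
variational inequality. -/
theorem IsGaussCone.exists_limit (hκ : IsKernel κ) (hE : EnergyPrinciple κ)
    (hC : ConsistencyPrinciple κ) (hS : IsGaussCone κ f C S) {u : ℕ → Measure X} {j : ℝ}
    (hu : ∀ n, u n ∈ S) (hj : ∀ σ ∈ S, j ≤ gauss κ f σ)
    (h : Tendsto (fun n => gauss κ f (u n)) atTop (𝓝 j)) :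
    ∃ μ ∈ finiteEnergy κ, StrongTendsto κ u μ ∧
      ∀ σ ∈ S, ∫⁻ x, f x ∂σ ≤ mutualEnergy κ μ σ := by
  obtain ⟨μ, hμ, huμ⟩ := hC.1 u (fun n => hS.subset (hu n)) (hS.strongCauchy hκ hE hu hj h)
  refine ⟨μ, hμ, huμ, fun σ hσ => ?_⟩
  rw [← ENNReal.toReal_le_toReal (hS.lintegral_ne_top hσ)
    (mutualEnergy_ne_top hκ hE hμ (hS.subset hσ))]
  exact hS.le_pairing hκ hE hu hj h hμ huμ hσ

theorem mutualEnergy_eq_lintegral_right (hκ : IsKernel κ) (hμ : μ ∈ posRadon X)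
    (hν : ν ∈ posRadon X) : mutualEnergy κ μ ν = ∫⁻ x, potential κ μ x ∂ν := by
  rw [mutualEnergy_comm hκ hμ hν, mutualEnergy_eq_lintegral hκ hμ]

/-! ### Measures concentrated on a set -/

theorem finiteEnergyOn_mono {B : Set X} (h : A ⊆ B) :
    finiteEnergyOn κ A ⊆ finiteEnergyOn κ B := fun _ hμ =>
  ⟨hμ.1, measure_mono_null (Set.compl_subset_compl.2 h) hμ.2⟩

theorem finiteEnergyOn_restrict (hκ : IsKernel κ) (hμ : μ ∈ finiteEnergyOn κ A) (B : Set X) :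
    μ.restrict B ∈ finiteEnergyOn κ A :=
  ⟨finiteEnergy_restrict hκ hμ.1 B,
    le_antisymm ((Measure.restrict_le_self _).trans hμ.2.le) zero_le⟩

theorem isGaussCone_finiteEnergyOn (hκ : IsKernel κ) (hE : EnergyPrinciple κ)
    (h : ∀ μ ∈ finiteEnergyOn κ A, (∫⁻ x, f x ∂μ) ^ 2 ≤ C * energy κ μ) :
    IsGaussCone κ f C (finiteEnergyOn κ A) where
  subset _ hμ := hμ.1
  zero_mem := ⟨zero_mem_finiteEnergy, by simp⟩
  add_mem μ hμ ν hν := ⟨finiteEnergy_add hκ hE hμ.1 hν.1, by simp [hμ.2, hν.2]⟩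
  smul_mem μ hμ c := ⟨finiteEnergy_smul hκ hμ.1 c, by simp [hμ.2]⟩
  bound := h

/-- The cones used are stable under restriction, so integrated inequalities become pointwise a.e.
ones. -/
theorem ae_le_of_forall_restrict {g : X → ℝ≥0∞} (hσ : σ ∈ posRadon X) (hf : Measurable f)
    (h : ∀ B : Set X, ∫⁻ x, f x ∂(σ.restrict B) ≤ ∫⁻ x, g x ∂(σ.restrict B)) :
    f ≤ᵐ[σ] g := by
  have := sigmaFinite_of_mem_posRadon hσ
  exact ae_le_of_forall_setLIntegral_le_of_sigmaFinite hf fun s _ _ => h s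

/-! ### Capacity -/

theorem inv_energy_le_capacity (hσ : σ ∈ posRadon X) (hK : σ Kᶜ = 0) (h1 : σ Set.univ = 1) :
    (energy κ σ)⁻¹ ≤ capacity κ K :=
  ENNReal.inv_le_inv.2 (iInf₂_le σ ⟨hσ, hK, h1⟩)

/-- The restriction of `σ` to `K`, normalized to unit mass, competes in the definition of the
capacity. -/
theorem sq_div_energy_le_capacity (hκ : IsKernel κ) (hσ : σ ∈ finiteEnergy κ)
    (hK : IsCompact K) : σ K ^ 2 / energy κ σ ≤ capacity κ K := by
  rcases eq_or_ne (σ K) 0 with h0 | h0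
  · simp [h0]
  have : IsFiniteMeasureOnCompacts σ := hσ.1
  have hfin : σ K ≠ ∞ := hK.measure_lt_top.ne
  obtain ⟨s, hs⟩ : ∃ s : ℝ≥0, (s : ℝ≥0∞) = (σ K)⁻¹ :=
    ⟨_, ENNReal.coe_toNNReal (ENNReal.inv_ne_top.2 h0)⟩
  have hr := finiteEnergy_restrict hκ hσ K
  have hsK : (s : ℝ≥0∞) * σ K = 1 := by rw [hs, ENNReal.inv_mul_cancel h0 hfin]
  refine le_trans ?_ (inv_energy_le_capacity (σ := s • σ.restrict K)
    (posRadon_smul hr.1 s) ?_ ?_)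
  · rw [energy_smul hκ hr.1, ENNReal.div_eq_inv_mul]
    refine ENNReal.le_inv_iff_mul_le.2 ?_
    have hle : energy κ (σ.restrict K) ≤ energy κ σ :=
      mutualEnergy_mono hκ hσ.1 Measure.restrict_le_self Measure.restrict_le_self
    calc (energy κ σ)⁻¹ * σ K ^ 2 * (s * (s * energy κ (σ.restrict K)))
        ≤ (energy κ σ)⁻¹ * σ K ^ 2 * (s * (s * energy κ σ)) := by gcongr
      _ = ((energy κ σ)⁻¹ * energy κ σ) * (s * σ K) ^ 2 := by ring
      _ ≤ 1 := by
        rw [hsK, one_pow, mul_one]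
        exact ENNReal.inv_mul_le_one _
  · rw [Measure.smul_apply, Measure.restrict_apply' hK.measurableSet, Set.compl_inter_self,
      measure_empty, smul_zero]
  · rw [Measure.smul_apply, Measure.restrict_apply_univ]
    exact hsK

theorem capacity_le_innerCapacity (hK : IsCompact K) (h : K ⊆ A) :
    capacity κ K ≤ innerCapacity κ A :=
  le_iSup₂_of_le K ⟨hK, h⟩ le_rfl

theorem sq_mass_le (hκ : IsKernel κ) (hσ : σ ∈ finiteEnergyOn κ K) (hK : IsCompact K)
    (h : K ⊆ A) (hA : innerCapacity κ A < ∞) :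
    σ Set.univ ^ 2 ≤ innerCapacity κ A * energy κ σ := by
  have h1 : σ Set.univ = σ K := by
    rw [← measure_add_measure_compl hK.measurableSet, hσ.2, add_zero]
  have h2 := (sq_div_energy_le_capacity hκ hσ.1 hK).trans (capacity_le_innerCapacity hK h)
  rwa [← h1, ENNReal.div_le_iff_le_mul (Or.inr hA.ne) (Or.inl hσ.1.2.ne)] at h2

/-- `A` need not be measurable: a measurable null hull of `Aᶜ` is removed before inner regularity is
applied. -/
theorem exists_isCompact_pos (hσ : σ ∈ posRadon X) (hA : σ Aᶜ = 0) {B : Set X}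
    (hB : MeasurableSet B) {r : ℝ≥0∞} (h : r < σ B) :
    ∃ K ⊆ A ∩ B, IsCompact K ∧ r < σ K := by
  have := regular_of_mem_posRadon hσ
  have := sigmaFinite_of_mem_posRadon hσ
  have hT : σ (toMeasurable σ Aᶜ) = 0 := by rw [measure_toMeasurable, hA]
  have hm : MeasurableSet (B \ toMeasurable σ Aᶜ) := hB.diff (measurableSet_toMeasurable _ _)
  rw [← measure_sdiff_null hT] at h
  obtain ⟨K, hKs, hK, hr⟩ := hm.exists_lt_isCompact h
  refine ⟨K, fun x hx => ⟨?_, (hKs hx).1⟩, hK, hr⟩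
  by_contra hxA
  exact (hKs hx).2 (subset_toMeasurable _ _ hxA)

/-- Otherwise `σ` would charge a compact part of the exceptional set, which would then have positive
capacity. -/
theorem NearlyEverywhereOn.ae (hκ : IsKernel κ) {P : X → Prop} (h : NearlyEverywhereOn κ A P)
    (hP : MeasurableSet {x | P x}) (hσ : σ ∈ finiteEnergyOn κ A) : ∀ᵐ x ∂σ, P x := by
  by_contra hne
  rw [ae_iff] at hne
  obtain ⟨K, hKs, hK, hpos⟩ := exists_isCompact_pos hσ.1.1 hσ.2 hP.compl (pos_iff_ne_zero.2 hne)
  have h1 := (sq_div_energy_le_capacity hκ hσ.1 hK).trans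
    (capacity_le_innerCapacity (κ := κ) hK (A := {x | x ∈ A ∧ ¬ P x}) hKs)
  rw [NearlyEverywhereOn] at h
  rw [h, nonpos_iff_eq_zero, ENNReal.div_eq_zero_iff] at h1
  rcases h1 with h1 | h1
  · exact hpos.ne' (by simpa using h1)
  · exact hσ.1.2.ne h1

/-- A property holds nearly everywhere if it holds almost everywhere for each measure of finite
energy with compact support in the set. -/
theorem nearlyEverywhereOn_of_ae {P : X → Prop}
    (h : ∀ K, IsCompact K → K ⊆ A → ∀ σ ∈ finiteEnergyOn κ K, ∀ᵐ x ∂σ, P x) :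
    NearlyEverywhereOn κ A P := by
  rw [NearlyEverywhereOn, innerCapacity]
  simp only [ENNReal.iSup_eq_zero]
  rintro K ⟨hK, hKs⟩
  rw [capacity, ENNReal.inv_eq_zero]
  simp only [iInf_eq_top]
  rintro σ ⟨hσ, hσK, h1⟩
  by_contra hne
  have h2 := h K hK (fun x hx => (hKs hx).1) σ ⟨⟨hσ, lt_top_iff_ne_top.2 hne⟩, hσK⟩
  have h3 : ∀ᵐ x ∂σ, x ∈ K := hσK
  have h4 : ∀ᵐ x ∂σ, False := by
    filter_upwards [h2, h3] with x hx hxK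
    exact (hKs hxK).2 hx
  have h5 : σ = 0 := by simpa using h4
  simp [h5] at h1

/-! ### Vague limits of measures on compact sets -/

theorem VagueTendsto.compl_null {u : ℕ → Measure X} (hK : IsCompact K) (hμ : μ ∈ posRadon X)
    (hu : ∀ n, u n Kᶜ = 0) (h : VagueTendsto u μ) : μ Kᶜ = 0 := by
  by_contra hne
  have := regular_of_mem_posRadon hμ
  have : IsFiniteMeasureOnCompacts μ := hμ
  obtain ⟨L, hLK, hL, hpos⟩ :=
    hK.isClosed.isOpen_compl.exists_lt_isCompact (pos_iff_ne_zero.2 hne)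
  obtain ⟨φ, h1, h0, hc, h01⟩ := exists_continuous_one_zero_of_isCompact hL hK.isClosed
    (Set.disjoint_left.2 hLK)
  have hz : ∀ n, ∫ x, φ x ∂(u n) = 0 := fun n => by
    refine integral_eq_zero_of_ae ?_
    have : ∀ᵐ x ∂(u n), x ∈ K := hu n
    filter_upwards [this] with x hx using h0 hx
  have h2 := h φ φ.continuous hc
  simp only [hz] at h2
  have h3 := tendsto_nhds_unique h2 tendsto_const_nhds
  have hint : Integrable φ μ := φ.continuous.integrable_of_hasCompactSupport hc
  rw [integral_eq_zero_iff_of_nonneg (fun x => (h01 x).1) hint] at h3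
  have h4 : μ L = 0 := by
    refine measure_mono_null ?_ h3
    intro x hx
    have : φ x = 1 := h1 hx
    simp [this]
  exact hpos.ne' h4

theorem stronglyClosedCone_of_isCompact (hC : ConsistencyPrinciple κ) (hK : IsCompact K) :
    StronglyClosedCone κ K := fun u hu μ hμ h =>
  ⟨hμ, (hC.2 u (fun n => (hu n).1) μ hμ h).compl_null hK hμ.1 fun n => (hu n).2⟩

/-- Tietze extension times a cutoff. Measures concentrated on `K` see only values on `K`, so vague
convergence can be tested on functions continuous merely on `K`. -/
theorem exists_extension (hK : IsCompact K) (hf : ContinuousOn f K) (hft : ∀ x ∈ K, f x ≠ ∞) :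
    ∃ φ : X → ℝ, Continuous φ ∧ HasCompactSupport φ ∧ ∀ x ∈ K, φ x = (f x).toReal := by
  let _ := TopologicalSpace.metrizableSpaceMetric X
  have hc : ContinuousOn (fun x => (f x).toReal) K :=
    ENNReal.continuousOn_toReal.comp hf hft
  obtain ⟨g, hg⟩ := ContinuousMap.exists_restrict_eq hK.isClosed ⟨_, hc.domRestrict⟩
  obtain ⟨ψ, h1, -, hψ, -⟩ := exists_continuous_one_zero_of_isCompact hK isClosed_empty
    (Set.disjoint_empty K)
  refine ⟨fun x => ψ x * g x, by fun_prop, hψ.mul_right, fun x hx => ?_⟩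
  have h2 : g x = (f x).toReal := congrArg (fun F => F ⟨x, hx⟩) hg
  have h3 : ψ x = 1 := h1 hx
  simp only [h2, h3, one_mul]

theorem VagueTendsto.lintegral {u : ℕ → Measure X} (hK : IsCompact K) (hf : Measurable f)
    (hfc : ContinuousOn f K) (hft : ∀ x ∈ K, f x ≠ ∞) (hu : ∀ n, u n Kᶜ = 0) (hμ : μ Kᶜ = 0)
    (h : VagueTendsto u μ) :
    Tendsto (fun n => (∫⁻ x, f x ∂(u n)).toReal) atTop (𝓝 (∫⁻ x, f x ∂μ).toReal) := by
  obtain ⟨φ, hφ, hc, hφf⟩ := exists_extension hK hfc hft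
  have key : ∀ ν : Measure X, ν Kᶜ = 0 → ∫ x, φ x ∂ν = (∫⁻ x, f x ∂ν).toReal := by
    intro ν hν
    have hν' : ∀ᵐ x ∂ν, x ∈ K := hν
    rw [← integral_toReal hf.aemeasurable]
    · refine integral_congr_ae ?_
      filter_upwards [hν'] with x hx using hφf x hx
    · filter_upwards [hν'] with x hx using lt_top_iff_ne_top.2 (hft x hx)
  have h1 := h φ hφ hc
  simpa only [key _ (hu _), key _ hμ] using h1

/-! ### The Gauss problem on compact sets and on general sets -/

theorem exists_gauss_minimizer (hκ : IsKernel κ) (hE : EnergyPrinciple κ)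
    (hC : ConsistencyPrinciple κ) (hf : Measurable f)
    (hA : StronglyClosedCone κ A) (hS : IsGaussCone κ f C (finiteEnergyOn κ A))
    (hcont : ∀ (u : ℕ → Measure X) (μ : Measure X), (∀ n, u n ∈ finiteEnergyOn κ A) →
      μ ∈ finiteEnergyOn κ A → StrongTendsto κ u μ →
        Tendsto (fun n => (∫⁻ x, f x ∂(u n)).toReal) atTop (𝓝 (∫⁻ x, f x ∂μ).toReal))
    (hP : ∀ ν ∈ finiteEnergy κ, (∀ᵐ x ∂ν, potential κ ν x ≤ f x) → ∀ x, potential κ ν x ≤ f x) :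
    ∃ μ ∈ finiteEnergyOn κ A, (∀ σ ∈ finiteEnergyOn κ A, gauss κ f μ ≤ gauss κ f σ) ∧
      ∀ x, potential κ μ x ≤ f x := by
  obtain ⟨u, j, hu, hj, hlim⟩ := hS.exists_minimizing
  obtain ⟨μ, hμ, huμ, hle⟩ := hS.exists_limit hκ hE hC hu hj hlim
  have hμA := hA u hu μ hμ huμ
  have hgauss : gauss κ f μ = j := tendsto_nhds_unique
    ((huμ.pairing_self hκ hE (fun n => (hu n).1) hμ).sub ((hcont u μ hu hμA huμ).const_mul 2)) hlim
  rw [← hgauss] at hj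
  refine ⟨μ, hμA, hj, hP μ hμ ?_⟩
  have hfin := hS.lintegral_ne_top hμA
  have h1 : mutualEnergy κ μ μ ≤ ∫⁻ x, f x ∂μ :=
    (ENNReal.toReal_le_toReal hμ.2.ne hfin).1 (hS.pairing_self_le hκ hμA hj)
  rw [mutualEnergy_eq_lintegral hκ hμ.1] at h1
  have h2 : f ≤ᵐ[μ] potential κ μ := by
    -- The variational inequality, tested on restrictions of `μ` itself, gives `f ≤ U^μ` `μ`-a.e.;
    -- `h1` turns it into equality.
    refine ae_le_of_forall_restrict hμ.1 hf fun B => ?_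
    have hr := finiteEnergyOn_restrict hκ hμA B
    rw [← mutualEnergy_eq_lintegral_right hκ hμ.1 hr.1.1]
    exact hle _ hr
  exact (ae_eq_of_ae_le_of_lintegral_le h2 hfin
    (measurable_potential hκ hμ.1).aemeasurable h1).symm.le

/-- If the Gauss problem is solvable on each compact subset of `A`, then it is solvable on `A`. -/
theorem exists_potential_eq (hκ : IsKernel κ) (hE : EnergyPrinciple κ)
    (hC : ConsistencyPrinciple κ) (hf : Measurable f) (hA : StronglyClosedCone κ A)
    (hb : ∀ K, IsCompact K → K ⊆ A → ∀ μ ∈ finiteEnergyOn κ K,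
      (∫⁻ x, f x ∂μ) ^ 2 ≤ C * energy κ μ)
    (hK : ∀ K, IsCompact K → K ⊆ A → ∃ μ ∈ finiteEnergyOn κ K,
      (∀ σ ∈ finiteEnergyOn κ K, gauss κ f μ ≤ gauss κ f σ) ∧ ∀ x, potential κ μ x ≤ f x) :
    ∃ μ ∈ finiteEnergyOn κ A, NearlyEverywhereOn κ A fun x => potential κ μ x = f x := by
  set S : Set (Measure X) := {μ | ∃ K, IsCompact K ∧ K ⊆ A ∧ μ ∈ finiteEnergyOn κ K} with hSdef
  have hcone : ∀ K, IsCompact K → K ⊆ A → IsGaussCone κ f C (finiteEnergyOn κ K) :=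
    fun K h1 h2 => isGaussCone_finiteEnergyOn hκ hE (hb K h1 h2)
  have hS : IsGaussCone κ f C S :=
    { subset := by rintro μ ⟨K, -, -, h⟩; exact h.1
      zero_mem := ⟨∅, isCompact_empty, Set.empty_subset _,
        (hcone ∅ isCompact_empty (Set.empty_subset _)).zero_mem⟩
      add_mem := by
        rintro μ ⟨K, hK1, hK2, h⟩ ν ⟨L, hL1, hL2, h'⟩
        exact ⟨K ∪ L, hK1.union hL1, Set.union_subset hK2 hL2,
          (hcone _ (hK1.union hL1) (Set.union_subset hK2 hL2)).add_mem _
            (finiteEnergyOn_mono Set.subset_union_left h) _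
            (finiteEnergyOn_mono Set.subset_union_right h')⟩
      smul_mem := by
        rintro μ ⟨K, hK1, hK2, h⟩ c
        exact ⟨K, hK1, hK2, (hcone K hK1 hK2).smul_mem _ h c⟩
      bound := by rintro μ ⟨K, hK1, hK2, h⟩; exact hb K hK1 hK2 μ h }
  obtain ⟨v, j, hv, hj, hlim⟩ := hS.exists_minimizing
  choose L hL hLA hvL using hv
  -- Replacing `v n` by the minimizer on its compact carrier `L n` keeps the sequence minimizing and
  -- adds the bound `U^(u n) ≤ f` everywhere.
  choose u huL hmin hule using fun n => hK (L n) (hL n) (hLA n)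
  have hu : ∀ n, u n ∈ S := fun n => ⟨L n, hL n, hLA n, huL n⟩
  have hlim' : Tendsto (fun n => gauss κ f (u n)) atTop (𝓝 j) :=
    tendsto_of_tendsto_of_tendsto_of_le_of_le tendsto_const_nhds hlim
      (fun n => hj _ (hu n)) fun n => hmin n _ (hvL n)
  obtain ⟨μ, hμ, huμ, hle⟩ := hS.exists_limit hκ hE hC hu hj hlim'
  have huA : ∀ n, u n ∈ finiteEnergyOn κ A := fun n => finiteEnergyOn_mono (hLA n) (huL n)
  refine ⟨μ, hA u huA μ hμ huμ, nearlyEverywhereOn_of_ae fun K hK1 hK2 σ hσ => ?_⟩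
  have h1 : f ≤ᵐ[σ] potential κ μ := by
    refine ae_le_of_forall_restrict hσ.1.1 hf fun B => ?_
    have hr := finiteEnergyOn_restrict hκ hσ B
    rw [← mutualEnergy_eq_lintegral_right hκ hμ.1 hr.1.1]
    exact hle _ ⟨K, hK1, hK2, hr⟩
  have h2 : potential κ μ ≤ᵐ[σ] f := by
    refine ae_le_of_forall_restrict hσ.1.1 (measurable_potential hκ hμ.1) fun B => ?_
    have hr := finiteEnergyOn_restrict hκ hσ B
    rw [← mutualEnergy_eq_lintegral_right hκ hμ.1 hr.1.1,
      ← ENNReal.toReal_le_toReal (mutualEnergy_ne_top hκ hE hμ hr.1)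
        ((hcone K hK1 hK2).lintegral_ne_top hr)]
    -- Only energies against a fixed measure pass to the limit, so no pointwise convergence of
    -- potentials is needed.
    refine le_of_tendsto' (huμ.pairing hκ hE (fun n => (huA n).1) hμ hr.1) fun n => ?_
    refine ENNReal.toReal_mono ((hcone K hK1 hK2).lintegral_ne_top hr) ?_
    rw [mutualEnergy_eq_lintegral_right hκ (huA n).1.1 hr.1.1]
    exact lintegral_mono (hule n)
  filter_upwards [h1, h2] with x hx hx' using le_antisymm hx' hx

theorem sq_mutualEnergy_le (hκ : IsKernel κ) (hE : EnergyPrinciple κ) (hμ : μ ∈ finiteEnergy κ)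
    (hν : ν ∈ finiteEnergy κ) : mutualEnergy κ μ ν ^ 2 ≤ energy κ μ * energy κ ν := by
  rw [← ENNReal.toReal_le_toReal (ENNReal.pow_ne_top (mutualEnergy_ne_top hκ hE hμ hν))
    (ENNReal.mul_ne_top hμ.2.ne hν.2.ne), ENNReal.toReal_pow, ENNReal.toReal_mul]
  exact sq_pairing_le hκ hE hμ hν

theorem lowerSemicontinuous_potential (hκ : IsKernel κ) (μ : Measure X) :
    LowerSemicontinuous (potential κ μ) := by
  rw [lowerSemicontinuous_iff_le_liminf]
  intro x
  have hm : ∀ x', Measurable (κ x') := fun x' => hκ.measurable.comp measurable_prodMk_left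
  refine le_trans (lintegral_mono fun y => ?_) (lintegral_liminf_le hm)
  have h : LowerSemicontinuous fun x' => κ x' y :=
    hκ.lsc.comp (by fun_prop : Continuous fun x' : X => (x', y))
  exact lowerSemicontinuous_iff_le_liminf.1 h x

/-! ### The inner equilibrium measure -/

theorem exists_equilibrium_potential (hκ : IsKernel κ) (hE : EnergyPrinciple κ)
    (hC : ConsistencyPrinciple κ) (hF : FrostmanPrinciple κ) (hA : StronglyClosedCone κ A)
    (hA1 : innerCapacity κ A < ∞) :
    ∃ γ ∈ finiteEnergyOn κ A, NearlyEverywhereOn κ A fun x => potential κ γ x = 1 := by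
  have hb : ∀ K, IsCompact K → K ⊆ A → ∀ μ ∈ finiteEnergyOn κ K,
      (∫⁻ _, (1 : ℝ≥0∞) ∂μ) ^ 2 ≤ (innerCapacity κ A).toNNReal * energy κ μ := by
    intro K hK hKA μ hμ
    rw [ENNReal.coe_toNNReal hA1.ne, lintegral_one]
    exact sq_mass_le hκ hμ hK hKA hA1
  refine exists_potential_eq hκ hE hC measurable_const hA hb fun K hK hKA => ?_
  refine exists_gauss_minimizer hκ hE hC measurable_const (stronglyClosedCone_of_isCompact hC hK)
    (isGaussCone_finiteEnergyOn hκ hE (hb K hK hKA)) ?_ ?_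
  · intro u μ hu hμ h
    exact (hC.2 u (fun n => (hu n).1) μ hμ.1 h).lintegral hK measurable_const continuousOn_const
      (by simp) (fun n => (hu n).2) hμ.2
  · intro ν hν h x
    simpa using hF ν hν 1 one_pos (by simpa using h) x

theorem mass_eq_lintegral (hκ : IsKernel κ) (hγ : NearlyEverywhereOn κ A fun x => potential κ γ x = 1)
    (hγA : γ ∈ finiteEnergyOn κ A) (hσ : σ ∈ finiteEnergyOn κ A) :
    σ Set.univ = mutualEnergy κ γ σ := by
  rw [mutualEnergy_eq_lintegral_right hκ hγA.1.1 hσ.1.1, ← lintegral_one]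
  refine lintegral_congr_ae ?_
  filter_upwards [hγ.ae hκ
    (measurableSet_eq_fun (measurable_potential hκ hγA.1.1) measurable_const) hσ] with x hx
  exact hx.symm

theorem NearlyEverywhereOn.mono {P Q : X → Prop} (h : NearlyEverywhereOn κ A P)
    (hPQ : ∀ x, P x → Q x) : NearlyEverywhereOn κ A Q := by
  refine le_antisymm (le_trans ?_ h.le) zero_le
  refine biSup_mono fun K hK => ⟨hK.1, fun x hx => ?_⟩
  exact ⟨(hK.2 hx).1, fun hP => (hK.2 hx).2 (hPQ x hP)⟩

/-- As `U^ν ≥ 1` holds `γ`-a.e., `I(γ, ν) ≥ γ(X) = I(γ)`; expanding `‖γ - ν‖²` gives the bound,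
hence both minimality and uniqueness. -/
theorem sqDist_le_of_mem_equilibriumClass (hκ : IsKernel κ) (hE : EnergyPrinciple κ)
    (hγ : NearlyEverywhereOn κ A fun x => potential κ γ x = 1)
    (hγA : γ ∈ finiteEnergyOn κ A) (hν : ν ∈ equilibriumClass κ A) (hfin : energy κ ν < ∞) :
    sqDist κ γ ν ≤ (energy κ ν).toReal - (energy κ γ).toReal := by
  have hν' : ν ∈ finiteEnergy κ := ⟨hν.1, hfin⟩
  have h1 : mutualEnergy κ γ γ ≤ mutualEnergy κ γ ν := by
    rw [← mass_eq_lintegral hκ hγ hγA hγA, mutualEnergy_eq_lintegral hκ hν.1, ← lintegral_one]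
    exact lintegral_mono_ae (hν.2.ae hκ
      (measurableSet_le measurable_const (measurable_potential hκ hν.1)) hγA)
  have h2 := ENNReal.toReal_mono (mutualEnergy_ne_top hκ hE hγA.1 hν') h1
  simp only [sqDist, pairing, energy]
  linarith

theorem isInnerEquilibrium_iff (hκ : IsKernel κ) (hE : EnergyPrinciple κ)
    (hγ : NearlyEverywhereOn κ A fun x => potential κ γ x = 1)
    (hγA : γ ∈ finiteEnergyOn κ A) : IsInnerEquilibrium κ A ν ↔ ν = γ := by
  have hmem : γ ∈ equilibriumClass κ A := ⟨hγA.1.1, hγ.mono fun x hx => hx.ge⟩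
  constructor
  · rintro ⟨hν, hfin, hmin⟩
    have hν' : ν ∈ finiteEnergy κ := ⟨hν.1, hfin⟩
    have h1 := sqDist_le_of_mem_equilibriumClass hκ hE hγ hγA hν hfin
    have h2 := ENNReal.toReal_mono hγA.1.2.ne (hmin γ hmem)
    exact (eq_of_sqDist_eq_zero hκ hE hγA.1 hν'
      (le_antisymm (by linarith) (sqDist_nonneg hκ hE hγA.1 hν'))).symm
  · rintro rfl
    refine ⟨hmem, hγA.1.2, fun ρ hρ => ?_⟩
    rcases eq_top_or_lt_top (energy κ ρ) with h | h
    · simp [h]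
    · rw [← ENNReal.toReal_le_toReal hγA.1.2.ne h.ne, ← sub_nonneg]
      exact (sqDist_nonneg hκ hE hγA.1 ⟨hρ.1, h⟩).trans
        (sqDist_le_of_mem_equilibriumClass hκ hE hγ hγA hρ h)

/-- Here `γ(X) = I(γ)`. Compact sets carrying almost all of `γ` give `γ(X) ≤ c_*(A)`; conversely, a
unit measure `σ` on `K ⊆ A` satisfies `1 = I(γ, σ)² ≤ I(γ) I(σ)`. -/
theorem equilibrium_mass (hκ : IsKernel κ) (hE : EnergyPrinciple κ)
    (hγ : NearlyEverywhereOn κ A fun x => potential κ γ x = 1)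
    (hγA : γ ∈ finiteEnergyOn κ A) : γ Set.univ = innerCapacity κ A := by
  have hM : γ Set.univ = energy κ γ := mass_eq_lintegral hκ hγ hγA hγA
  have hMfin : γ Set.univ ≠ ∞ := hM ▸ hγA.1.2.ne
  apply le_antisymm
  · rcases eq_or_ne (γ Set.univ) 0 with h0 | h0
    · simp [h0]
    have key : ∀ r, r < γ Set.univ → r ^ 2 ≤ innerCapacity κ A * γ Set.univ := by
      intro r hr
      obtain ⟨K, hKA, hK, hrK⟩ := exists_isCompact_pos hγA.1.1 hγA.2 MeasurableSet.univ hr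
      have h1 := (sq_div_energy_le_capacity hκ hγA.1 hK).trans
        (capacity_le_innerCapacity hK (hKA.trans Set.inter_subset_left))
      rw [← hM, ENNReal.div_le_iff h0 hMfin] at h1
      exact le_trans (by gcongr) h1
    have : (𝓝[<] (γ Set.univ)).NeBot := nhdsLT_neBot_of_exists_lt ⟨0, pos_iff_ne_zero.2 h0⟩
    have h2 : γ Set.univ ^ 2 ≤ innerCapacity κ A * γ Set.univ :=
      le_of_tendsto (x := 𝓝[<] (γ Set.univ)) (((ENNReal.continuous_pow 2).tendsto _).mono_left nhdsWithin_le_nhds)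
        (eventually_nhdsWithin_of_forall key)
    rw [sq] at h2
    exact (ENNReal.mul_le_mul_iff_left h0 hMfin).1 h2
  · refine iSup₂_le fun K ⟨hK, hKA⟩ => ?_
    rw [capacity, ENNReal.inv_le_iff_inv_le]
    refine le_iInf₂ fun σ ⟨hσ, hσK, h1⟩ => ?_
    rcases eq_top_or_lt_top (energy κ σ) with h | h
    · simp [h]
    have hσA : σ ∈ finiteEnergyOn κ A := finiteEnergyOn_mono hKA ⟨⟨hσ, h⟩, hσK⟩
    have h2 := sq_mutualEnergy_le hκ hE hγA.1 hσA.1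
    rw [← mass_eq_lintegral hκ hγ hγA hσA, h1, one_pow, ← hM] at h2
    rwa [ENNReal.inv_le_iff_le_mul (fun h' => by simp_all) (fun h' => absurd h' hMfin)]

/-! ### The inner balayage -/

/-- For `ω` of finite energy, Cauchy–Schwarz gives `C = I(ω)`, and `∫ U^ω dσ = I(σ, ω)` is strongly
continuous. Otherwise `U^ω ≤ m` on `A` gives `C = m² c_*(A)`, and continuity of `U^ω` on `K` makes
vague convergence enough. -/
theorem exists_balayage (hκ : IsKernel κ) (hE : EnergyPrinciple κ)
    (hC : ConsistencyPrinciple κ) (hD : DominationPrinciple κ) (hA : StronglyClosedCone κ A)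
    (hA1 : innerCapacity κ A < ∞) (hω : AdmissibleCharge κ A ω) :
    ∃ ν, IsInnerBalayage κ A ω ν := by
  obtain ⟨hωR, -, hω⟩ := hω
  have hm := measurable_potential hκ hωR
  have hP : ∀ ν ∈ finiteEnergy κ, (∀ᵐ x ∂ν, potential κ ν x ≤ potential κ ω x) →
      ∀ x, potential κ ν x ≤ potential κ ω x := fun ν hν h => hD ν hν ω hωR h
  rcases hω with hω | ⟨-, husc, m, hbd⟩
  · have hb : ∀ K, IsCompact K → K ⊆ A → ∀ μ ∈ finiteEnergyOn κ K,
        (∫⁻ x, potential κ ω x ∂μ) ^ 2 ≤ (energy κ ω).toNNReal * energy κ μ := by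
      intro K _ _ μ hμ
      rw [ENNReal.coe_toNNReal hω.2.ne, ← mutualEnergy_eq_lintegral_right hκ hωR hμ.1.1]
      exact sq_mutualEnergy_le hκ hE hω hμ.1
    refine exists_potential_eq hκ hE hC hm hA hb fun K hK hKA => ?_
    refine exists_gauss_minimizer hκ hE hC hm (stronglyClosedCone_of_isCompact hC hK)
      (isGaussCone_finiteEnergyOn hκ hE (hb K hK hKA)) ?_ hP
    intro u μ hu hμ h
    simp only [← mutualEnergy_eq_lintegral hκ hωR]
    exact h.pairing hκ hE (fun n => (hu n).1) hμ.1 hω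
  · have hb : ∀ K, IsCompact K → K ⊆ A → ∀ μ ∈ finiteEnergyOn κ K,
        (∫⁻ x, potential κ ω x ∂μ) ^ 2 ≤
          (m ^ 2 * (innerCapacity κ A).toNNReal : ℝ≥0) * energy κ μ := by
      intro K hK hKA μ hμ
      have hμK : ∀ᵐ x ∂μ, x ∈ K := hμ.2
      have h1 : ∫⁻ x, potential κ ω x ∂μ ≤ m * μ Set.univ := by
        rw [← lintegral_const]
        refine lintegral_mono_ae ?_
        filter_upwards [hμK] with x hx using hbd x (hKA hx)
      calc (∫⁻ x, potential κ ω x ∂μ) ^ 2 ≤ (m * μ Set.univ) ^ 2 := by gcongr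
        _ = m ^ 2 * μ Set.univ ^ 2 := by ring
        _ ≤ m ^ 2 * (innerCapacity κ A * energy κ μ) := by
          gcongr
          exact sq_mass_le hκ hμ hK hKA hA1
        _ = _ := by
          rw [ENNReal.coe_mul, ENNReal.coe_toNNReal hA1.ne, ENNReal.coe_pow, mul_assoc]
    refine exists_potential_eq hκ hE hC hm hA hb fun K hK hKA => ?_
    refine exists_gauss_minimizer hκ hE hC hm (stronglyClosedCone_of_isCompact hC hK)
      (isGaussCone_finiteEnergyOn hκ hE (hb K hK hKA)) ?_ hP
    intro u μ hu hμ h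
    refine (hC.2 u (fun n => (hu n).1) μ hμ.1 h).lintegral hK hm ?_ ?_
      (fun n => (hu n).2) hμ.2
    · exact continuousOn_iff_lower_upperSemicontinuousOn.2
        ⟨(lowerSemicontinuous_potential hκ ω).lowerSemicontinuousOn K, husc K hK hKA⟩
    · exact fun x hx => ((hbd x (hKA hx)).trans_lt ENNReal.coe_lt_top).ne

theorem IsInnerBalayage.ae_eq (hκ : IsKernel κ) (hω : ω ∈ posRadon X)
    (h : IsInnerBalayage κ A ω ν) (hσ : σ ∈ finiteEnergyOn κ A) :
    potential κ ν =ᵐ[σ] potential κ ω :=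
  h.2.ae hκ (measurableSet_eq_fun (measurable_potential hκ h.1.1.1) (measurable_potential hκ hω)) hσ

theorem IsInnerBalayage.mutualEnergy_eq (hκ : IsKernel κ) (hω : ω ∈ posRadon X)
    (h : IsInnerBalayage κ A ω ν) (hσ : σ ∈ finiteEnergyOn κ A) :
    mutualEnergy κ ν σ = ∫⁻ x, potential κ ω x ∂σ := by
  rw [mutualEnergy_eq_lintegral_right hκ h.1.1.1 hσ.1.1]
  exact lintegral_congr_ae (h.ae_eq hκ hω hσ)

/-- Both energies and the mutual energy are integrals of the same `U^ω`, so they coincide and `‖μ -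
ν‖² = 0`. -/
theorem IsInnerBalayage.unique (hκ : IsKernel κ) (hE : EnergyPrinciple κ) (hω : ω ∈ posRadon X)
    (hμ : IsInnerBalayage κ A ω μ) (hν : IsInnerBalayage κ A ω ν) : μ = ν := by
  refine eq_of_sqDist_eq_zero hκ hE hμ.1.1 hν.1.1 ?_
  have h1 : pairing κ μ ν = pairing κ ν ν := by
    rw [pairing, pairing, hμ.mutualEnergy_eq hκ hω hν.1, hν.mutualEnergy_eq hκ hω hν.1]
  have h2 : pairing κ ν μ = pairing κ μ μ := by
    rw [pairing, pairing, hμ.mutualEnergy_eq hκ hω hμ.1, hν.mutualEnergy_eq hκ hω hμ.1]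
  have h3 := pairing_comm hκ hμ.1.1 hν.1.1
  rw [sqDist]
  linarith

end BalayageTheory

end

theorem mainTheorem10 {X : Type*} [TopologicalSpace X] [T2Space X] [LocallyCompactSpace X]
    [SecondCountableTopology X] [MeasurableSpace X] [BorelSpace X]
    (κ : X → X → ℝ≥0∞) (hκ : BalayageTheory.IsKernel κ)
    (hE : BalayageTheory.EnergyPrinciple κ)
    (hC : BalayageTheory.ConsistencyPrinciple κ)
    (hD : BalayageTheory.DominationPrinciple κ)
    (hF : BalayageTheory.FrostmanPrinciple κ)
    (A : Set X) (hA : BalayageTheory.StronglyClosedCone κ A)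
    (hA0 : 0 < BalayageTheory.innerCapacity κ A)
    (hA1 : BalayageTheory.innerCapacity κ A < ∞)
    (ω : Measure X) (hω : BalayageTheory.AdmissibleCharge κ A ω) :
    (∃! ν : Measure X, BalayageTheory.IsInnerBalayage κ A ω ν) ∧
    (∃! γ : Measure X, BalayageTheory.IsInnerEquilibrium κ A γ) ∧
    ∀ ωA γA : Measure X, BalayageTheory.IsInnerBalayage κ A ω ωA →
      BalayageTheory.IsInnerEquilibrium κ A γA →
        γA Set.univ = BalayageTheory.innerCapacity κ A ∧
        ωA Set.univ = ∫⁻ x, BalayageTheory.potential κ ω x ∂γA := by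
  obtain ⟨γ, hγA, hγ⟩ :=
    BalayageTheory.exists_equilibrium_potential hκ hE hC hF hA hA1
  obtain ⟨ν, hν⟩ := BalayageTheory.exists_balayage hκ hE hC hD hA hA1 hω
  refine ⟨⟨ν, hν, fun ν' hν' => hν'.unique hκ hE hω.1 hν⟩,
    ⟨γ, (BalayageTheory.isInnerEquilibrium_iff hκ hE hγ hγA).2 rfl,
      fun γ' hγ' => (BalayageTheory.isInnerEquilibrium_iff hκ hE hγ hγA).1 hγ'⟩, ?_⟩
  intro ωA γA hωA hγA'
  obtain rfl := (BalayageTheory.isInnerEquilibrium_iff hκ hE hγ hγA).1 hγA'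
  refine ⟨BalayageTheory.equilibrium_mass hκ hE hγ hγA, ?_⟩
  -- `I(γ, ω^A)` is computed twice: through `U^γ = 1` it is the mass of `ω^A`, and through `U^(ω^A)
  -- = U^ω` it is `∫ U^ω dγ`.
  rw [BalayageTheory.mass_eq_lintegral hκ hγ hγA hωA.1,
    BalayageTheory.mutualEnergy_comm hκ hγA.1.1 hωA.1.1.1, hωA.mutualEnergy_eq hκ hω.1 hγA]
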